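/- All logarithms are to base 2, $h_b(p)=-p\log p-(1-p)\log(1-p)$ is the binary entropy function, $h_b^{-1}:[0,1]\to[0,1/2]$ is the inverse of its restriction to $[0,1/2]$, $a*b=a(1-b)+(1-a)b$, $|x|^+=\max(x,0)$, and $\oplus$ is addition modulo 2. Let $0\le p_1,p_3,\delta<1/2$. Consider the following memoryless three-user interference channel with feedback. In each channel use, transmitter 1 sends $(X_{11},X_{12})$ with $X_{11}\in\mathbb Z/3$ and $X_{12}\in\{0,1\}$, transmitter 2 sends $X_2\in\{0,1\}$, and transmitter 3 sends $(X_{32},X_{33},X'_{33})\in\{0,1\}^3$. With $N_1,N_3,N_\delta,E$ mutually independent Bernoulli random variables with parameters $p_1,p_3,\delta,1/2$ (drawn afresh, independently, in each channel use), receiver 1 observes $Y_1=X_{11}+E \bmod 3$; receiver 2 observes $(Y_2,Y_2',Y_2'')=(X_2\oplus E\oplus N_\delta,\; X_{12}\oplus N_1,\; X_{32}\oplus N_3)$; and receiver 3 observes $Y_3=(Y_{33},Y_{33}')=(X_{33}\oplus N_\delta,\; X'_{33}\oplus E)$. The feedback, available at the transmitters with one unit of delay, is $Z_1=Y_1$ at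 transmitter 1, $Z_3=Y_3$ at transmitter 3, and there is none at transmitter 2. (This is the case $\epsilon=0$ of the channel in which $Z_1=Y_1+N_\epsilon \bmod 3$ with an independent Bernoulli($\epsilon$) variable $N_\epsilon$.) An $(M_1,M_2,M_3,N)$ feedback-block-code consists of encoding functions $f_{i,n}:\{1,\dots,M_i\}\times\mathcal Z_i^{n-1}\to\mathcal X_i$, $1\le n\le N$, and decoding functions $g_i:\mathcal Y_i^N\to\{1,\dots,M_i\}$, $i=1,2,3$, where $\mathcal X_i,\mathcal Y_i,\mathcal Z_i$ are the input, output and feedback alphabets of user $i$. The messages $W_i$ are independent and uniform on $\{1,\dots,M_i\}$, the input of transmitter $i$ at time $n$ is $f_{i,n}(W_i,Z_i^{n-1})$, and $P_e$ is the probability that $(g_1(Y_1^N),g_2(Y_2^N),g_3(Y_3^N))\ne(W_1,W_2,W_3)$, where $Y_i^N$ is everything that receiver $i$ observes. A rate triple $(R_1,R_2,R_3)$ is achievable if for every $\eta>0$ there is an $(M_1,M_2,M_3,N)$ feedback-block-code with $P_e\le\eta$ and $\frac1N\log M_i\ge R_i-\eta$ for $i=1,2,3$. Then the rate triple $(\log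 3-1,\;1-h_b(d),\;1-h_b(\delta))$ is achievable, where $d=h_b^{-1}\big(|h_b(p_1*\delta)+h_b(p_3)-1|^+\big)$. -/

import Mathlib

/-- A three-user memoryless interference channel with generalized feedback, over finite alphabets:
`Q x y` is the transition probability `Q(y₁,y₂,y₃ | x₁,x₂,x₃)` and `P y z` is the feedback
probability `P(z₁,z₂,z₃ | y₁,y₂,y₃)`. -/
structure ICFB (X₁ X₂ X₃ Y₁ Y₂ Y₃ Z₁ Z₂ Z₃ : Type)
    [Fintype Y₁] [Fintype Y₂] [Fintype Y₃] [Fintype Z₁] [Fintype Z₂] [Fintype Z₃] where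
  Q : X₁ × X₂ × X₃ → Y₁ × Y₂ × Y₃ → ℝ
  Q_nonneg : ∀ x y, 0 ≤ Q x y
  Q_sum : ∀ x, ∑ y, Q x y = 1
  P : Y₁ × Y₂ × Y₃ → Z₁ × Z₂ × Z₃ → ℝ
  P_nonneg : ∀ y z, 0 ≤ P y z
  P_sum : ∀ y, ∑ z, P y z = 1

/-- An `(M₁, M₂, M₃, N)` feedback-block-code. The times `1, …, N` are indexed by `n : Fin N`
(so `n` counts from `0`), and at time `n` encoder `i` has seen exactly the `n` earlier feedback
symbols `Z_i`. -/
structure FeedbackBlockCode (X₁ X₂ X₃ Y₁ Y₂ Y₃ Z₁ Z₂ Z₃ : Type) (M₁ M₂ M₃ N : ℕ) where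
  enc₁ : (n : Fin N) → Fin M₁ → (Fin n → Z₁) → X₁
  enc₂ : (n : Fin N) → Fin M₂ → (Fin n → Z₂) → X₂
  enc₃ : (n : Fin N) → Fin M₃ → (Fin n → Z₃) → X₃
  dec₁ : (Fin N → Y₁) → Fin M₁
  dec₂ : (Fin N → Y₂) → Fin M₂
  dec₃ : (Fin N → Y₃) → Fin M₃

namespace FeedbackBlockCode

variable {X₁ X₂ X₃ Y₁ Y₂ Y₃ Z₁ Z₂ Z₃ : Type} {M₁ M₂ M₃ N : ℕ}

/-- The channel input at time `n`, for the message triple `w` and the feedback sequence `z`. It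
depends on `z` only through the symbols at times earlier than `n`. -/
def input (c : FeedbackBlockCode X₁ X₂ X₃ Y₁ Y₂ Y₃ Z₁ Z₂ Z₃ M₁ M₂ M₃ N)
    (w : Fin M₁ × Fin M₂ × Fin M₃) (z : Fin N → Z₁ × Z₂ × Z₃) (n : Fin N) : X₁ × X₂ × X₃ :=
  (c.enc₁ n w.1 (fun k => (z (Fin.castLE n.isLt.le k)).1),
   c.enc₂ n w.2.1 (fun k => (z (Fin.castLE n.isLt.le k)).2.1),
   c.enc₃ n w.2.2 (fun k => (z (Fin.castLE n.isLt.le k)).2.2))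

/-- The decoded message triple. -/
def decode (c : FeedbackBlockCode X₁ X₂ X₃ Y₁ Y₂ Y₃ Z₁ Z₂ Z₃ M₁ M₂ M₃ N)
    (y : Fin N → Y₁ × Y₂ × Y₃) : Fin M₁ × Fin M₂ × Fin M₃ :=
  (c.dec₁ (fun n => (y n).1), c.dec₂ (fun n => (y n).2.1), c.dec₃ (fun n => (y n).2.2))

variable [Fintype Y₁] [Fintype Y₂] [Fintype Y₃] [Fintype Z₁] [Fintype Z₂] [Fintype Z₃]

/-- The probability that the output and feedback sequences are `y` and `z`, given that the message
triple is `w`, when the code is used on the channel `C`. -/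
def law (c : FeedbackBlockCode X₁ X₂ X₃ Y₁ Y₂ Y₃ Z₁ Z₂ Z₃ M₁ M₂ M₃ N)
    (C : ICFB X₁ X₂ X₃ Y₁ Y₂ Y₃ Z₁ Z₂ Z₃) (w : Fin M₁ × Fin M₂ × Fin M₃)
    (y : Fin N → Y₁ × Y₂ × Y₃) (z : Fin N → Z₁ × Z₂ × Z₃) : ℝ :=
  ∏ n, C.Q (c.input w z n) (y n) * C.P (y n) (z n)

/-- The probability `P((W₁,W₂,W₃) ≠ (Ŵ₁,Ŵ₂,Ŵ₃))` for independent uniformly distributed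
messages. -/
noncomputable def errorProb (c : FeedbackBlockCode X₁ X₂ X₃ Y₁ Y₂ Y₃ Z₁ Z₂ Z₃ M₁ M₂ M₃ N)
    (C : ICFB X₁ X₂ X₃ Y₁ Y₂ Y₃ Z₁ Z₂ Z₃) : ℝ :=
  ((M₁ : ℝ) * M₂ * M₃)⁻¹ *
    ∑ w : Fin M₁ × Fin M₂ × Fin M₃, ∑ y : Fin N → Y₁ × Y₂ × Y₃, ∑ z : Fin N → Z₁ × Z₂ × Z₃,
      if c.decode y = w then 0 else c.law C w y z

end FeedbackBlockCode

namespace ICFB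

variable {X₁ X₂ X₃ Y₁ Y₂ Y₃ Z₁ Z₂ Z₃ : Type}
  [Fintype Y₁] [Fintype Y₂] [Fintype Y₃] [Fintype Z₁] [Fintype Z₂] [Fintype Z₃]

/-- `η`-achievability of the rate triple `(R₁, R₂, R₃)`; rates are in bits per channel use. -/
def EpsAchievable (C : ICFB X₁ X₂ X₃ Y₁ Y₂ Y₃ Z₁ Z₂ Z₃) (η R₁ R₂ R₃ : ℝ) : Prop :=
  ∃ M₁ M₂ M₃ N : ℕ, 0 < M₁ ∧ 0 < M₂ ∧ 0 < M₃ ∧ 0 < N ∧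
    ∃ c : FeedbackBlockCode X₁ X₂ X₃ Y₁ Y₂ Y₃ Z₁ Z₂ Z₃ M₁ M₂ M₃ N,
      c.errorProb C ≤ η ∧
      R₁ - η ≤ 1 / (N : ℝ) * Real.logb 2 M₁ ∧
      R₂ - η ≤ 1 / (N : ℝ) * Real.logb 2 M₂ ∧
      R₃ - η ≤ 1 / (N : ℝ) * Real.logb 2 M₃

/-- Achievability of the rate triple `(R₁, R₂, R₃)`. -/
def Achievable (C : ICFB X₁ X₂ X₃ Y₁ Y₂ Y₃ Z₁ Z₂ Z₃) (R₁ R₂ R₃ : ℝ) : Prop :=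
  ∀ η : ℝ, 0 < η → C.EpsAchievable η R₁ R₂ R₃

end ICFB

/-- The binary entropy function, in bits. -/
noncomputable def hb (p : ℝ) : ℝ := Real.binEntropy p / Real.log 2

/-- The inverse of the binary entropy function restricted to `[0, 1/2]`. -/
noncomputable def hbInv : ℝ → ℝ := Function.invFunOn hb (Set.Icc 0 (1 / 2))

/-- Binary convolution `p * q = p (1 - q) + (1 - p) q`. -/
def binConv (p q : ℝ) : ℝ := p * (1 - q) + (1 - p) * q

/-- The Bernoulli distribution with parameter `p`. -/
def bern (p : ℝ) (b : Bool) : ℝ := if b then p else 1 - p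

namespace SecondExample

/-- The residue modulo 3 of a bit. -/
def toTernary (b : Bool) : ZMod 3 := if b then 1 else 0

/-- The channel outputs `Y₁`, `(Y₂, Y₂', Y₂'')`, `(Y₃₃, Y₃₃')` as a function of the inputs
`(X₁₁, X₁₂)`, `X₂`, `(X₃₂, X₃₃, X₃₃')` and of the noise bits `(N₁, N₃, N_δ, E)`:
`Y₁ = X₁₁ + E` modulo 3, `Y₂ = X₂ ⊕ E ⊕ N_δ`, `Y₂' = X₁₂ ⊕ N₁`, `Y₂'' = X₃₂ ⊕ N₃`,
`Y₃₃ = X₃₃ ⊕ N_δ`, `Y₃₃' = X₃₃' ⊕ E`. -/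
def output : (ZMod 3 × Bool) × Bool × (Bool × Bool × Bool) → Bool × Bool × Bool × Bool →
    ZMod 3 × (Bool × Bool × Bool) × (Bool × Bool)
  | ((x₁₁, x₁₂), x₂, (x₃₂, x₃₃, x₃₃')), (n₁, n₃, nδ, e) =>
    (x₁₁ + toTernary e,
     (xor x₂ (xor e nδ), xor x₁₂ n₁, xor x₃₂ n₃),
     (xor x₃₃ nδ, xor x₃₃' e))

/-- The law of the independent noise bits `(N₁, N₃, N_δ, E)`. -/
noncomputable def noiseLaw (p₁ p₃ δ : ℝ) : Bool × Bool × Bool × Bool → ℝ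
  | (n₁, n₃, nδ, e) => bern p₁ n₁ * bern p₃ n₃ * bern δ nδ * bern (1 / 2) e

/-- The feedback `Z₁ = Y₁ + N_ε` modulo 3, `Z₂` trivial, `Z₃ = (Y₃₃, Y₃₃')`. -/
def feedback (y : ZMod 3 × (Bool × Bool × Bool) × (Bool × Bool)) (nε : Bool) :
    ZMod 3 × Unit × (Bool × Bool) :=
  (y.1 + toTernary nε, (), y.2.2)

theorem bern_nonneg (p : unitInterval) (b : Bool) : 0 ≤ bern p b := by
  have h0 := p.2.1
  have h1 := p.2.2
  unfold bern
  split_ifs <;> linarith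

/-- The interference channel with feedback, with noise parameters `p₁, p₃, δ, ε`. -/
noncomputable def channel (p₁ p₃ δ ε : unitInterval) :
    ICFB (ZMod 3 × Bool) Bool (Bool × Bool × Bool)
      (ZMod 3) (Bool × Bool × Bool) (Bool × Bool)
      (ZMod 3) Unit (Bool × Bool) where
  Q x y := ∑ v, if output x v = y then noiseLaw p₁ p₃ δ v else 0
  Q_nonneg x y := by
    refine Finset.sum_nonneg fun v _ => ?_
    split_ifs
    · obtain ⟨n₁, n₃, nδ, e⟩ := v
      have h : 0 ≤ bern (1 / 2) e := by unfold bern; split_ifs <;> norm_num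
      exact mul_nonneg (mul_nonneg (mul_nonneg (bern_nonneg _ _) (bern_nonneg _ _))
        (bern_nonneg _ _)) h
    · exact le_rfl
  Q_sum x := by
    rw [Finset.sum_comm]
    simp only [Finset.sum_ite_eq, Finset.mem_univ, if_true]
    simp only [Fintype.sum_prod_type, Fintype.sum_bool, noiseLaw, bern]
    simp
    ring
  P y z := ∑ n, if feedback y n = z then bern ε n else 0
  P_nonneg y z := by
    refine Finset.sum_nonneg fun v _ => ?_
    split_ifs
    · exact bern_nonneg _ _
    · exact le_rfl
  P_sum y := by
    rw [Finset.sum_comm]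
    simp [bern]

end SecondExample

open Filter Finset Topology

/-!
Users 1 and 3 use random codes for additive noise. User 2 is hindered by the fair bit `E`, about
which the other two transmitters learn from their feedback. Over blocks of length `n`, transmitter 1
knows its codeword, hence recovers `E` from `Y₁` and forwards it uncoded in the next block;
transmitter 3 recovers `E ⊕ N_δ` from `Y₃` and sends a random function of the whole sequence in the
next block. Adding the forwarded bits to `Y₂`, receiver 2 sees its codeword in the noise `N_δ ⊕ N₁`,
which it checks to be typical for the entropy `h_b (p₁ * δ)`. For each candidate codeword it also
computes the value that `E ⊕ N_δ` would have, and compares the function at this value with its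
version in the noise `N₃`. A wrong candidate passes both tests with probability about `2 ^ (-n c)`,
where `c = 2 - h_b (p₁ * δ) - h_b p₃`, unless its codeword is the right one, which has probability
`2 ^ (-n)`. All three users lose only the last block, in which no message is sent.
-/

section FiniteProbability

variable {Ω α β γ ι κ : Type*}

/-- The probability of the event `A` under the mass function `p` on a finite type. -/
noncomputable def prob [Fintype Ω] (p : Ω → ℝ) (A : Set Ω) : ℝ := ∑ ω, A.indicator p ω

section Events

variable [Fintype Ω] {p : Ω → ℝ} {A B : Set Ω}

theorem prob_univ (p : Ω → ℝ) : prob p Set.univ = ∑ ω, p ω := by simp [prob]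

theorem prob_singleton (p : Ω → ℝ) (ω : Ω) : prob p {ω} = p ω := by
  classical
  simp [prob, Set.indicator_apply]

theorem prob_nonneg (hp : 0 ≤ p) (A : Set Ω) : 0 ≤ prob p A :=
  sum_nonneg fun ω _ => Set.indicator_nonneg (fun ω _ => hp ω) ω

theorem prob_mono_of_ne_zero (hp : 0 ≤ p) (h : ∀ ω ∈ A, p ω ≠ 0 → ω ∈ B) :
    prob p A ≤ prob p B := by
  refine sum_le_sum fun ω _ => Set.indicator_apply_le' (fun hω => ?_) fun _ =>
    Set.indicator_nonneg (fun ω _ => hp ω) ω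
  rcases eq_or_ne (p ω) 0 with h0 | h0
  · exact h0 ▸ Set.indicator_nonneg (fun ω _ => hp ω) ω
  · rw [Set.indicator_of_mem (h ω hω h0)]

theorem prob_mono (hp : 0 ≤ p) (h : A ⊆ B) : prob p A ≤ prob p B :=
  prob_mono_of_ne_zero hp fun _ hω _ => h hω

theorem prob_setOf_exists_mem_le (hp : 0 ≤ p) (t : Finset ι) (A : ι → Set Ω) :
    prob p {ω | ∃ i ∈ t, ω ∈ A i} ≤ ∑ i ∈ t, prob p (A i) := by
  simp only [prob]
  rw [sum_comm]
  have hind (i : ι) (ω : Ω) : 0 ≤ (A i).indicator p ω :=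
    Set.indicator_nonneg (fun ω _ => hp ω) ω
  refine sum_le_sum fun ω _ => Set.indicator_apply_le' ?_ fun _ => sum_nonneg fun i _ => hind i ω
  rintro ⟨i, hit, hi⟩
  rw [← Set.indicator_of_mem hi p]
  exact single_le_sum (f := fun i => (A i).indicator p ω) (fun i _ => hind i ω) hit

theorem prob_union_le (hp : 0 ≤ p) (A B : Set Ω) : prob p (A ∪ B) ≤ prob p A + prob p B := by
  simpa [Set.union_def, or_comm] using prob_setOf_exists_mem_le hp univ fun b : Bool => cond b A B

theorem sum_prob_le_of_pairwiseDisjoint (hp : 0 ≤ p) {t : Finset ι} {A : ι → Set Ω}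
    (hA : (t : Set ι).PairwiseDisjoint A) (hB : ∀ i ∈ t, A i ⊆ B) :
    ∑ i ∈ t, prob p (A i) ≤ prob p B := by
  have hunion : prob p (⋃ i ∈ t, A i) = ∑ i ∈ t, prob p (A i) := by
    simp only [prob, indicator_biUnion t A hA]
    exact sum_comm
  exact hunion ▸ prob_mono hp (Set.iUnion₂_subset hB)

end Events

/-- The random variable `g` on the finite probability space `(Ω, p)` has the mass function `q`. -/
def HasLaw [Fintype Ω] (p : Ω → ℝ) (g : Ω → β) (q : β → ℝ) : Prop :=
  ∀ b, prob p (g ⁻¹' {b}) = q b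

theorem HasLaw.prob_preimage [Fintype Ω] [Fintype β] {p : Ω → ℝ} {g : Ω → β} {q : β → ℝ}
    (h : HasLaw p g q) (A : Set β) : prob p (g ⁻¹' A) = prob q A := by
  classical
  calc prob p (g ⁻¹' A) = ∑ ω, ∑ b, A.indicator (fun b => (g ⁻¹' {b}).indicator p ω) b := by
        refine sum_congr rfl fun ω _ => ?_
        rw [Fintype.sum_eq_single (g ω) fun b hb => by
          simp [Set.indicator_apply, hb.symm]]
        simp [Set.indicator_apply]
    _ = ∑ b, A.indicator (fun b => prob p (g ⁻¹' {b})) b := by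
        rw [sum_comm]
        refine sum_congr rfl fun b _ => ?_
        by_cases hb : b ∈ A <;> simp [hb, prob]
    _ = prob q A := congrArg (prob · A) (funext h)

theorem HasLaw.comp [Fintype Ω] [Fintype β] {p : Ω → ℝ} {g : Ω → β} {q : β → ℝ} {h : β → γ}
    {r : γ → ℝ} (hh : HasLaw q h r) (hg : HasLaw p g q) : HasLaw p (fun ω => h (g ω)) r :=
  fun c => (hg.prob_preimage (h ⁻¹' {c})).trans (hh c)

section Product

variable [Fintype α] [Fintype β]

/-- The mass function of a pair of independent random variables with mass functions `p`, `q`. -/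
def prodLaw (p : α → ℝ) (q : β → ℝ) (x : α × β) : ℝ := p x.1 * q x.2

theorem prob_prodLaw (p : α → ℝ) (q : β → ℝ) (S : Set (α × β)) :
    prob (prodLaw p q) S = ∑ a, p a * prob q {b | (a, b) ∈ S} := by
  classical
  simp only [prob, Fintype.sum_prod_type, Set.indicator_apply, prodLaw, mul_sum, mul_ite, mul_zero]
  rfl

theorem prob_prodLaw_right (p : α → ℝ) (q : β → ℝ) (S : Set (α × β)) :
    prob (prodLaw p q) S = ∑ b, q b * prob p {a | (a, b) ∈ S} := by
  classical
  simp only [prob, Fintype.sum_prod_type_right, Set.indicator_apply, prodLaw, mul_sum, mul_ite,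
    mul_zero, mul_comm (p _)]
  rfl

theorem prob_prodLaw_le_mul {p : α → ℝ} (hp : 0 ≤ p) (q : β → ℝ) {S : Set (α × β)} {A : Set α}
    {t : ℝ} (hA : ∀ x ∈ S, x.1 ∈ A) (ht : ∀ a ∈ A, prob q {b | (a, b) ∈ S} ≤ t) :
    prob (prodLaw p q) S ≤ prob p A * t := by
  rw [prob_prodLaw, prob, sum_mul]
  refine sum_le_sum fun a _ => ?_
  by_cases ha : a ∈ A
  · simpa [ha] using mul_le_mul_of_nonneg_left (ht a ha) (hp a)
  · have hempty : {b | (a, b) ∈ S} = ∅ := Set.eq_empty_of_forall_notMem fun b hb => ha (hA _ hb)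
    simp [ha, hempty, prob]

theorem prob_prodLaw_prod (p : α → ℝ) (q : β → ℝ) (A : Set α) (B : Set β) :
    prob (prodLaw p q) (A ×ˢ B) = prob p A * prob q B := by
  classical
  rw [prob_prodLaw, prob, sum_mul]
  refine sum_congr rfl fun a _ => ?_
  by_cases ha : a ∈ A <;> simp [ha, prob]

theorem prodLaw_mem_stdSimplex {p : α → ℝ} {q : β → ℝ} (hp : p ∈ stdSimplex ℝ α)
    (hq : q ∈ stdSimplex ℝ β) : prodLaw p q ∈ stdSimplex ℝ (α × β) := by
  refine ⟨fun x => mul_nonneg (hp.1 x.1) (hq.1 x.2), ?_⟩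
  rw [← prob_univ, ← Set.univ_prod_univ, prob_prodLaw_prod, prob_univ, prob_univ, hp.2, hq.2,
    one_mul]

theorem hasLaw_fst (p : α → ℝ) {q : β → ℝ} (hq : q ∈ stdSimplex ℝ β) :
    HasLaw (prodLaw p q) Prod.fst p := fun a => by
  rw [← Set.prod_univ, prob_prodLaw_prod, prob_univ, hq.2, mul_one, prob_singleton]

theorem hasLaw_snd {p : α → ℝ} (hp : p ∈ stdSimplex ℝ α) (q : β → ℝ) :
    HasLaw (prodLaw p q) Prod.snd q := fun b => by
  rw [← Set.univ_prod, prob_prodLaw_prod, prob_univ, hp.2, one_mul, prob_singleton]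

theorem HasLaw.prodMap {α' β' : Type*} {p : α → ℝ} {q : β → ℝ} {g : α → α'} {h : β → β'}
    {p' : α' → ℝ} {q' : β' → ℝ} (hg : HasLaw p g p') (hh : HasLaw q h q') :
    HasLaw (prodLaw p q) (Prod.map g h) (prodLaw p' q') := fun ⟨a, b⟩ => by
  rw [← Set.singleton_prod_singleton, Set.preimage_prod_map_prod, prob_prodLaw_prod, hg a, hh b,
    prodLaw]

end Product

section Iid

variable [Fintype ι] [DecidableEq ι] [Fintype α] {p : α → ℝ}

/-- The mass function of a family of independent random variables with mass function `p`. -/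
def iidLaw (p : α → ℝ) (v : ι → α) : ℝ := ∏ i, p (v i)

theorem prob_iidLaw_pi (p : α → ℝ) (A : ι → Set α) :
    prob (iidLaw p) (Set.univ.pi A) = ∏ i, prob p (A i) := by
  classical
  simp only [prob, prod_univ_sum, Fintype.piFinset_univ]
  refine sum_congr rfl fun v _ => ?_
  simp only [Set.indicator_apply, prod_ite_zero, Set.mem_univ_pi, mem_univ, true_imp_iff]
  rfl

theorem iidLaw_mem_stdSimplex (hp : p ∈ stdSimplex ℝ α) :
    (iidLaw p : (ι → α) → ℝ) ∈ stdSimplex ℝ (ι → α) := by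
  refine ⟨fun v => prod_nonneg fun i _ => hp.1 (v i), ?_⟩
  rw [← prob_univ, ← Set.pi_univ Set.univ, prob_iidLaw_pi]
  simp [prob_univ, hp.2]

theorem HasLaw.iidLaw {g : α → β} {q : β → ℝ} (h : HasLaw p g q) :
    HasLaw (iidLaw p) (fun (v : ι → α) i => g (v i)) (iidLaw q) := fun b => by
  have hpre : (fun (v : ι → α) i => g (v i)) ⁻¹' {b} = Set.univ.pi fun i => g ⁻¹' {b i} := by
    ext v
    simp [funext_iff]
  rw [hpre, prob_iidLaw_pi]
  exact prod_congr rfl fun i _ => h (b i)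

theorem hasLaw_iidLaw_comp [Fintype κ] (hp : p ∈ stdSimplex ℝ α) {e : κ → ι}
    (he : Function.Injective e) : HasLaw (iidLaw p) (fun (v : ι → α) k => v (e k)) (iidLaw p) := by
  intro b
  have hpre : (fun (v : ι → α) k => v (e k)) ⁻¹' {b} =
      Set.univ.pi fun i => {a | ∀ k, e k = i → a = b k} := by
    ext v
    simpa [funext_iff] using ⟨by rintro h i k rfl; exact h k, fun h k => h _ k rfl⟩
  rw [hpre, prob_iidLaw_pi]
  refine (Fintype.prod_of_injective e he (fun k => p (b k)) _ (fun i hi => ?_) fun k => ?_).symm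
  · have : {a | ∀ k, e k = i → a = b k} = Set.univ :=
      Set.eq_univ_of_forall fun a k hk => absurd ⟨k, hk⟩ hi
    rw [this, prob_univ, hp.2]
  · simp [he.eq_iff, prob_singleton]

theorem hasLaw_iidLaw_prodMk [Fintype κ] (hp : p ∈ stdSimplex ℝ α) {e e' : κ → ι}
    (he : Function.Injective (Sum.elim e e')) :
    HasLaw (iidLaw p) (fun (v : ι → α) k => (v (e k), v (e' k))) (iidLaw (prodLaw p p)) := by
  intro b
  have hpre : (fun (v : ι → α) k => (v (e k), v (e' k))) ⁻¹' {b} =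
      (fun v j => v (Sum.elim e e' j)) ⁻¹' {Sum.elim (fun k => (b k).1) fun k => (b k).2} := by
    ext v
    simp [funext_iff, Prod.ext_iff, forall_and]
  rw [hpre, hasLaw_iidLaw_comp hp he]
  simp [iidLaw, prodLaw, prod_mul_distrib]

theorem hasLaw_iidLaw_apply (hp : p ∈ stdSimplex ℝ α) (i : ι) :
    HasLaw (iidLaw p) (fun v : ι → α => v i) p := fun a => by
  have hpre : (fun v : ι → α => v i) ⁻¹' {a} =
      (fun v (_ : Unit) => v i) ⁻¹' {fun _ => a} := by
    ext v
    simp [funext_iff]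
  rw [hpre, hasLaw_iidLaw_comp hp (Function.injective_of_subsingleton _)]
  simp [iidLaw]

end Iid

section Uniform

variable [Fintype α] [Fintype β]

/-- The uniform mass function on a finite type. -/
noncomputable def uniformLaw (α : Type*) [Fintype α] (_ : α) : ℝ := (Fintype.card α : ℝ)⁻¹

theorem uniformLaw_mem_stdSimplex [Nonempty α] : uniformLaw α ∈ stdSimplex ℝ α :=
  ⟨fun _ => inv_nonneg.2 (Nat.cast_nonneg _), by simp [uniformLaw]⟩

theorem prob_uniformLaw (T : Finset α) : prob (uniformLaw α) T = #T / Fintype.card α := by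
  classical
  simp [prob, uniformLaw, Set.indicator_apply, div_eq_mul_inv]

theorem uniformLaw_prod : uniformLaw (α × β) = prodLaw (uniformLaw α) (uniformLaw β) := by
  funext x
  simp [uniformLaw, prodLaw, mul_comm]

theorem hasLaw_uniformLaw_fst [Nonempty β] :
    HasLaw (uniformLaw (α × β)) Prod.fst (uniformLaw α) :=
  uniformLaw_prod (α := α) (β := β) ▸ hasLaw_fst _ uniformLaw_mem_stdSimplex

theorem hasLaw_uniformLaw_snd [Nonempty α] :
    HasLaw (uniformLaw (α × β)) Prod.snd (uniformLaw β) :=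
  uniformLaw_prod (α := α) (β := β) ▸ hasLaw_snd uniformLaw_mem_stdSimplex _

theorem uniformLaw_pi [Fintype ι] [DecidableEq ι] :
    uniformLaw (ι → α) = iidLaw (uniformLaw α) := by
  funext x
  simp [uniformLaw, iidLaw]

theorem hasLaw_uniformLaw_equiv (e : α ≃ β) : HasLaw (uniformLaw α) e (uniformLaw β) := fun b => by
  have hpre : e ⁻¹' {b} = {e.symm b} := by
    ext a
    simp [e.eq_symm_apply]
  rw [hpre, prob_singleton, uniformLaw, uniformLaw, Fintype.card_congr e]

end Uniform

end FiniteProbability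

section LargeDeviations

variable {α : Type*} [Fintype α]

theorem prob_iidLaw_lt_sum_le_pow {p : α → ℝ} (hp : 0 ≤ p) (f : α → ℝ) (c : ℝ) {l : ℝ}
    (hl : 0 ≤ l) (n : ℕ) :
    prob (iidLaw p) {v : Fin n → α | n * c < ∑ t, f (v t)} ≤
      (∑ a, p a * Real.exp (l * (f a - c))) ^ n := by
  rw [Fintype.sum_pow]
  refine sum_le_sum fun v _ => Set.indicator_apply_le' (fun hv => ?_) fun _ =>
    prod_nonneg fun t _ => mul_nonneg (hp _) (Real.exp_nonneg _)
  rw [prod_mul_distrib, ← Real.exp_sum, ← mul_sum, sum_sub_distrib]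
  refine le_mul_of_one_le_right (prod_nonneg fun t _ => hp _) (Real.one_le_exp ?_)
  have hv' : n * c ≤ ∑ t, f (v t) := le_of_lt hv
  exact mul_nonneg hl (by simpa using hv')

theorem exists_sum_mul_exp_lt_one {p : α → ℝ} (hp : p ∈ stdSimplex ℝ α) {f : α → ℝ} {c : ℝ}
    (hc : ∑ a, p a * f a < c) : ∃ l > 0, ∑ a, p a * Real.exp (l * (f a - c)) < 1 := by
  have hderiv : HasDerivAt (fun l => ∑ a, p a * Real.exp (l * (f a - c)))
      (∑ a, p a * (f a - c)) 0 := by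
    refine HasDerivAt.fun_sum fun a _ => ?_
    simpa using (((hasDerivAt_id (0 : ℝ)).mul_const (f a - c)).exp).const_mul (p a)
  have hneg : ∑ a, p a * (f a - c) < 0 := by
    simpa [mul_sub, ← sum_mul, hp.2] using hc
  have hslope := hderiv.tendsto_slope.mono_left (nhdsGT_le_nhdsNE 0)
  obtain ⟨l, hl, hl0⟩ := ((hslope.eventually (gt_mem_nhds hneg)).and self_mem_nhdsWithin).exists
  have hl0 : 0 < l := hl0
  refine ⟨l, hl0, ?_⟩
  simpa [slope_def_field, div_neg_iff, hp.2, hl0, hl0.not_gt] using hl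

theorem tendsto_prob_iidLaw_lt_sum {p : α → ℝ} (hp : p ∈ stdSimplex ℝ α) {f : α → ℝ} {c : ℝ}
    (hc : ∑ a, p a * f a < c) :
    Tendsto (fun n : ℕ => prob (iidLaw p) {v : Fin n → α | n * c < ∑ t, f (v t)}) atTop (𝓝 0) := by
  obtain ⟨l, hl, hl1⟩ := exists_sum_mul_exp_lt_one hp hc
  exact squeeze_zero (fun n => prob_nonneg (iidLaw_mem_stdSimplex hp).1 _)
    (prob_iidLaw_lt_sum_le_pow hp.1 f c hl.le)
    (tendsto_pow_atTop_nhds_zero_of_lt_one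
      (sum_nonneg fun a _ => mul_nonneg (hp.1 a) (Real.exp_nonneg _)) hl1)

end LargeDeviations

section Typicality

variable {β : Type*} [Fintype β]

/-- The Shannon entropy, in bits, of a mass function on a finite type. -/
noncomputable def shannonEntropy (q : β → ℝ) : ℝ := (∑ b, Real.negMulLog (q b)) / Real.log 2

/-- The sequences of length `n` with probability at least `2 ^ (-n c)` under the product of `n`
copies of `q`. -/
noncomputable def typicalSet (q : β → ℝ) (c : ℝ) (n : ℕ) : Finset (Fin n → β) :=
  univ.filter fun s => (2 : ℝ) ^ (-(n * c)) ≤ iidLaw q s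

theorem card_typicalSet_le {q : β → ℝ} (hq : q ∈ stdSimplex ℝ β) (c : ℝ) (n : ℕ) :
    (#(typicalSet q c n) : ℝ) ≤ 2 ^ (n * c) := by
  have hlaw := iidLaw_mem_stdSimplex (ι := Fin n) hq
  have h : #(typicalSet q c n) • (2 : ℝ) ^ (-(n * c)) ≤ 1 := by
    rw [← hlaw.2]
    exact (card_nsmul_le_sum _ _ _ fun s hs => (mem_filter.1 hs).2).trans
      (sum_le_univ_sum_of_nonneg hlaw.1)
  rwa [nsmul_eq_mul, Real.rpow_neg two_pos.le, ← div_eq_mul_inv, div_le_one (by positivity)] at h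

theorem sum_mul_neg_logb_eq_shannonEntropy (q : β → ℝ) :
    ∑ b, q b * -Real.logb 2 (q b) = shannonEntropy q := by
  simp [shannonEntropy, sum_div, Real.negMulLog, Real.logb, neg_div, mul_div_assoc]

theorem tendsto_prob_notMem_typicalSet {q : β → ℝ} (hq : q ∈ stdSimplex ℝ β) {c : ℝ}
    (hc : shannonEntropy q < c) :
    Tendsto (fun n : ℕ => prob (iidLaw q) {s | s ∉ typicalSet q c n}) atTop (𝓝 0) := by
  rw [← sum_mul_neg_logb_eq_shannonEntropy] at hc
  have hlaw (n : ℕ) : 0 ≤ (iidLaw q : (Fin n → β) → ℝ) := (iidLaw_mem_stdSimplex hq).1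
  refine squeeze_zero (fun n => prob_nonneg (hlaw n) _) (fun n => ?_)
    (tendsto_prob_iidLaw_lt_sum hq hc)
  refine prob_mono_of_ne_zero (hlaw n) fun s hs hs0 => ?_
  have hlt : iidLaw q s < 2 ^ (-(n * c)) := by simpa [typicalSet] using hs
  have hpos : 0 < iidLaw q s := (hlaw n s).lt_of_ne' hs0
  rw [← Real.logb_lt_iff_lt_rpow one_lt_two hpos, iidLaw,
    Real.logb_prod _ _ fun t _ => prod_ne_zero_iff.1 hs0 t (mem_univ t)] at hlt
  simpa using lt_neg_of_lt_neg hlt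

end Typicality

section RandomCoding

variable {G H K Ω Y ι : Type*} [Fintype K] [Fintype Ω] [Fintype ι]

theorem exists_prob_le_of_forall_prob_le {q : K → ℝ} (hq : q ∈ stdSimplex ℝ K) {P : Ω → ℝ}
    (hP : P ∈ stdSimplex ℝ Ω) {S : Set (K × Ω)} {a : ℝ} (h : ∀ ω, prob q {k | (k, ω) ∈ S} ≤ a) :
    ∃ k, prob P {ω | (k, ω) ∈ S} ≤ a := by
  by_contra! hlt
  have hle : prob (prodLaw q P) S ≤ a := by
    rw [prob_prodLaw_right, ← one_mul a, ← hP.2, sum_mul]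
    exact sum_le_sum fun ω _ => mul_le_mul_of_nonneg_left (h ω) (hP.1 ω)
  obtain ⟨k₀, hk₀⟩ : ∃ k, 0 < q k := by
    by_contra! hq0
    exact absurd hq.2 ((sum_nonpos fun k _ => hq0 k).trans_lt one_pos).ne
  refine hle.not_gt ?_
  rw [prob_prodLaw, ← one_mul a, ← hq.2, sum_mul]
  exact sum_lt_sum (fun k _ => mul_le_mul_of_nonneg_left (hlt k).le (hq.1 k))
    ⟨k₀, mem_univ k₀, mul_lt_mul_of_pos_left (hlt k₀) hk₀⟩

/-- Random coding: the code is drawn from `q`, and the decoder returns any message that passes the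
test. -/
theorem exists_code_of_test [Nonempty ι] {q : K → ℝ} (hq : q ∈ stdSimplex ℝ K) {μ : ι → ℝ}
    (hμ : μ ∈ stdSimplex ℝ ι) {P : Ω → ℝ} (hP : P ∈ stdSimplex ℝ Ω) (out : K → ι → Ω → Y)
    (test : K → Y → ι → Prop) (bad : Set Ω) {a : ℝ}
    (hpass : ∀ k w, ∀ ω ∉ bad, test k (out k w ω) w)
    (hwrong : ∀ w w' ω, w' ≠ w → prob q {k | test k (out k w ω) w'} ≤ a) :
    ∃ k, ∃ dec : Y → ι, prob (prodLaw μ P) {x | dec (out k x.1 x.2) ≠ x.1} ≤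
      (Fintype.card ι - 1) * a + prob P bad := by
  classical
  have hμP := prodLaw_mem_stdSimplex hμ hP
  have hconfused (x : ι × Ω) :
      prob q {k | ∃ w' ∈ univ.erase x.1, test k (out k x.1 x.2) w'} ≤ (Fintype.card ι - 1) * a := by
    refine (prob_setOf_exists_mem_le hq.1 _ _).trans <| (sum_le_card_nsmul _ _ a fun w' hw' =>
      hwrong x.1 w' x.2 (ne_of_mem_erase hw')).trans_eq ?_
    rw [card_erase_of_mem (mem_univ _), card_univ, nsmul_eq_mul, Nat.cast_pred Fintype.card_pos]
  obtain ⟨k, hk⟩ := exists_prob_le_of_forall_prob_le hq hμP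
    (S := {z | ∃ w' ∈ univ.erase z.2.1, test z.1 (out z.1 z.2.1 z.2.2) w'}) hconfused
  refine ⟨k, fun y => Classical.epsilon (test k y), ?_⟩
  have hbad : prob (prodLaw μ P) (Set.univ ×ˢ bad) = prob P bad := by
    rw [prob_prodLaw_prod, prob_univ, hμ.2, one_mul]
  rw [← hbad]
  refine le_trans (prob_mono hμP.1 fun x hx => ?_) ((prob_union_le hμP.1 _ _).trans
    (add_le_add_left hk _))
  by_cases hx' : x.2 ∈ bad
  · exact Or.inr ⟨trivial, hx'⟩
  · exact Or.inl ⟨_, mem_erase.2 ⟨hx, mem_univ _⟩,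
      Classical.epsilon_spec ⟨x.1, hpass k x.1 x.2 hx'⟩⟩

section Group

variable [AddCommGroup G] [Fintype G]

theorem hasLaw_apply_sub_apply [DecidableEq ι] {i j : ι} (hij : i ≠ j) :
    HasLaw (uniformLaw (ι → G)) (fun F => F i - F j) (uniformLaw G) := by
  let e : (ι → G) ≃ (ι → G) :=
    { toFun F := F - Pi.single i (F j)
      invFun F := F + Pi.single i (F j)
      left_inv F := by simp [hij.symm]
      right_inv F := by simp [hij.symm] }
  have hi : HasLaw (uniformLaw (ι → G)) (fun F => F i) (uniformLaw G) := by
    rw [uniformLaw_pi]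
    exact hasLaw_iidLaw_apply uniformLaw_mem_stdSimplex i
  simpa [e] using hi.comp (hasLaw_uniformLaw_equiv e)

theorem prob_apply_add_sub_apply_mem [DecidableEq ι] {i j : ι} (hij : i ≠ j) (g : G)
    (T : Finset G) :
    prob (uniformLaw (ι → G)) {F | F i + g - F j ∈ T} = #T / Fintype.card G := by
  rw [← prob_uniformLaw, ← ((hasLaw_uniformLaw_equiv (Equiv.addRight g)).comp
    (hasLaw_apply_sub_apply hij)).prob_preimage]
  simp [Set.preimage, sub_add_eq_add_sub]

theorem exists_code_of_additive_noise [Nonempty ι] {P : Ω → ℝ} (hP : P ∈ stdSimplex ℝ Ω)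
    (s : Ω → G) (T : Finset G) :
    ∃ (c : ι → G) (dec : G → ι),
      prob (prodLaw (uniformLaw ι) P) {x | dec (c x.1 + s x.2) ≠ x.1} ≤
        (Fintype.card ι - 1) * (#T / Fintype.card G) + prob P {ω | s ω ∉ T} := by
  classical
  exact exists_code_of_test (q := uniformLaw (ι → G)) uniformLaw_mem_stdSimplex
    uniformLaw_mem_stdSimplex hP (fun c w ω => c w + s ω) (fun c y w => y - c w ∈ T) _
    (fun c w ω hω => by simpa using hω)
    fun w w' ω hne => (prob_apply_add_sub_apply_mem hne.symm (s ω) T).le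

variable [AddCommGroup H] [Fintype H]

/-- Either the two codewords coincide, or the two values of `F` are at different points and the
tests `T` and `T'` are passed independently. -/
theorem prob_confused_le [DecidableEq ι] [DecidableEq G] {i j : ι} (hij : i ≠ j) (g u : G) (k : H)
    (T : Finset G) (T' : Finset H) :
    prob (prodLaw (uniformLaw (ι → G)) (uniformLaw (G → H)))
        {x | x.1 i + u - x.1 j ∈ T ∧ x.2 g + k - x.2 (x.1 i + g - x.1 j) ∈ T'} ≤
      1 / Fintype.card G + #T / Fintype.card G * (#T' / Fintype.card H) := by
  set S := {x : (ι → G) × (G → H) |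
    x.1 i + u - x.1 j ∈ T ∧ x.2 g + k - x.2 (x.1 i + g - x.1 j) ∈ T'}
  set same := {c : ι → G | c i = c j}
  have hlaw := prodLaw_mem_stdSimplex (uniformLaw_mem_stdSimplex (α := ι → G))
    (uniformLaw_mem_stdSimplex (α := G → H))
  have hsame : prob (prodLaw (uniformLaw (ι → G)) (uniformLaw (G → H))) (same ×ˢ Set.univ) =
      1 / Fintype.card G := by
    rw [prob_prodLaw_prod, prob_univ, uniformLaw_mem_stdSimplex.2, mul_one]
    simpa [sub_eq_zero] using prob_apply_add_sub_apply_mem hij (0 : G) {0}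
  have hdiff : prob (prodLaw (uniformLaw (ι → G)) (uniformLaw (G → H))) {x ∈ S | x.1 ∉ same} ≤
      #T / Fintype.card G * (#T' / Fintype.card H) := by
    rw [← prob_apply_add_sub_apply_mem hij u T]
    refine prob_prodLaw_le_mul uniformLaw_mem_stdSimplex.1 _ (fun x hx => hx.1.1) fun c _ => ?_
    by_cases hc : c ∈ same
    · simpa [hc, prob] using by positivity
    · have hne : g ≠ c i + g - c j := fun h => hc (by
        simpa [same, add_comm, eq_sub_iff_add_eq, eq_comm] using h)
      exact (prob_mono uniformLaw_mem_stdSimplex.1 fun F hF => hF.1.2).trans_eq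
        (prob_apply_add_sub_apply_mem hne k T')
  rw [← hsame]
  refine (prob_mono hlaw.1 fun x hx => ?_).trans
    ((prob_union_le hlaw.1 _ _).trans (add_le_add_right hdiff _))
  by_cases hx' : x.1 ∈ same
  · exact Or.inl ⟨hx', trivial⟩
  · exact Or.inr ⟨hx, hx'⟩

/-- The decoder subtracts each candidate codeword from the first signal, and compares the value of
`F` at the difference with the third one. -/
theorem exists_code_of_additive_noise_and_description [Nonempty ι] {P : Ω → ℝ}
    (hP : P ∈ stdSimplex ℝ Ω) (s u : Ω → G) (k : Ω → H) (T : Finset G) (T' : Finset H) :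
    ∃ (c : ι → G) (F : G → H) (dec : G × G × H → ι),
      prob (prodLaw (uniformLaw ι) P)
          {x | dec (c x.1 + s x.2, c x.1 + u x.2, F (s x.2) + k x.2) ≠ x.1} ≤
        (Fintype.card ι - 1) *
            (1 / Fintype.card G + #T / Fintype.card G * (#T' / Fintype.card H)) +
          (prob P {ω | u ω ∉ T} + prob P {ω | k ω ∉ T'}) := by
  classical
  obtain ⟨⟨c, F⟩, dec, h⟩ := exists_code_of_test (ι := ι)
    (prodLaw_mem_stdSimplex (uniformLaw_mem_stdSimplex (α := ι → G))
      (uniformLaw_mem_stdSimplex (α := G → H)))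
    uniformLaw_mem_stdSimplex hP
    (fun x w ω => (x.1 w + s ω, x.1 w + u ω, x.2 (s ω) + k ω))
    (fun x y w => y.2.1 - x.1 w ∈ T ∧ y.2.2 - x.2 (y.1 - x.1 w) ∈ T')
    ({ω | u ω ∉ T} ∪ {ω | k ω ∉ T'}) (fun x w ω hω => by simpa using hω)
    fun w w' ω hne => prob_confused_le hne.symm (s ω) (u ω) (k ω) T T'
  exact ⟨c, F, dec, h.trans (add_le_add_right (prob_union_le hP.1 _ _) _)⟩

end Group

end RandomCoding

section AsymptoticCoding

variable {G H : Type*} [Fintype G] [Fintype H]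

/-- The size `⌈2 ^ (n r)⌉` of a message set of rate `r` bits per symbol at block length `n`. -/
noncomputable def numMessages (n : ℕ) (r : ℝ) : ℕ := ⌈(2 : ℝ) ^ (n * r)⌉₊

instance (n : ℕ) (r : ℝ) : NeZero (numMessages n r) := ⟨(Nat.ceil_pos.2 (by positivity)).ne'⟩

theorem mul_le_logb_numMessages (n : ℕ) (r : ℝ) : n * r ≤ Real.logb 2 (numMessages n r) := by
  rw [Real.le_logb_iff_rpow_le one_lt_two (Nat.cast_pos.2 (NeZero.pos _))]
  exact Nat.le_ceil _

theorem sub_le_rate_of_mul_le_logb {B n m : ℕ} (hn : 0 < n) {R η : ℝ} (hη : 0 < η) (hR : R ≤ 1)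
    (hB : 2 / η ≤ B) (hm : n * (R - η / 2) ≤ Real.logb 2 m) :
    R - η ≤ 1 / (((B + 1) * n : ℕ) : ℝ) * Real.logb 2 ((m ^ B : ℕ) : ℝ) := by
  have hblock : (B : ℝ) * (n * (R - η / 2)) ≤ B * Real.logb 2 m :=
    mul_le_mul_of_nonneg_left hm B.cast_nonneg
  have hloss : (R - η) * (B + 1) ≤ B * (R - η / 2) := by
    rw [div_le_iff₀ hη] at hB
    linarith
  rw [Nat.cast_pow, Real.logb_pow, one_div_mul_eq_div, le_div_iff₀ (by positivity)]
  push_cast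
  calc (R - η) * ((B + 1) * n) = (R - η) * (B + 1) * n := (mul_assoc _ _ _).symm
    _ ≤ B * (R - η / 2) * n := mul_le_mul_of_nonneg_right hloss n.cast_nonneg
    _ = B * (n * (R - η / 2)) := by ring
    _ ≤ B * Real.logb 2 m := hblock

theorem numMessages_sub_one_le (n : ℕ) (r : ℝ) : (numMessages n r : ℝ) - 1 ≤ 2 ^ (n * r) :=
  sub_le_iff_le_add.2 (Nat.ceil_lt_add_one (by positivity)).le

theorem tendsto_numMessages_sub_one_mul {r a : ℝ} (h : r + a < 0) {f : ℕ → ℝ}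
    (hf₀ : ∀ n, 0 ≤ f n) (hf : ∀ n, f n ≤ 2 ^ (n * a)) :
    Tendsto (fun n => ((numMessages n r : ℝ) - 1) * f n) atTop (𝓝 0) := by
  refine squeeze_zero (fun n => mul_nonneg ?_ (hf₀ n)) (fun n => ?_)
    (tendsto_pow_atTop_nhds_zero_of_lt_one (r := (2 : ℝ) ^ (r + a)) (by positivity)
      (Real.rpow_lt_one_of_one_lt_of_neg one_lt_two h))
  · exact sub_nonneg.2 (Nat.one_le_cast.2 (NeZero.one_le))
  · calc ((numMessages n r : ℝ) - 1) * f n ≤ 2 ^ (n * r) * 2 ^ (n * a) :=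
          mul_le_mul (numMessages_sub_one_le n r) (hf n) (hf₀ n) (by positivity)
      _ = (2 ^ (r + a)) ^ n := by
          rw [← Real.rpow_add two_pos, ← mul_add, mul_comm, Real.rpow_mul two_pos.le,
            Real.rpow_natCast]

theorem card_pi_eq_two_rpow [Nonempty G] (n : ℕ) :
    (Fintype.card (Fin n → G) : ℝ) = 2 ^ (n * Real.logb 2 (Fintype.card G)) := by
  rw [mul_comm, Real.rpow_mul two_pos.le, Real.rpow_logb two_pos one_lt_two.ne'
    (Nat.cast_pos.2 Fintype.card_pos), Real.rpow_natCast]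
  simp

theorem card_typicalSet_div_le [Nonempty G] {q : G → ℝ} (hq : q ∈ stdSimplex ℝ G) (c : ℝ) (n : ℕ) :
    (#(typicalSet q c n) : ℝ) / Fintype.card (Fin n → G) ≤
      2 ^ (n * (c - Real.logb 2 (Fintype.card G))) := by
  rw [mul_sub, Real.rpow_sub two_pos, ← card_pi_eq_two_rpow]
  exact div_le_div_of_nonneg_right (card_typicalSet_le hq c n) (Nat.cast_nonneg _)

variable {Ω : ℕ → Type*} [∀ n, Fintype (Ω n)] {P : (n : ℕ) → Ω n → ℝ} {r η : ℝ}

theorem tendsto_prob_apply_notMem_typicalSet {q : G → ℝ} (hq : q ∈ stdSimplex ℝ G)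
    {s : (n : ℕ) → Ω n → Fin n → G} (hs : ∀ n, HasLaw (P n) (s n) (iidLaw q)) {c : ℝ}
    (hc : shannonEntropy q < c) :
    Tendsto (fun n => prob (P n) {ω | s n ω ∉ typicalSet q c n}) atTop (𝓝 0) :=
  (tendsto_prob_notMem_typicalSet hq hc).congr fun n => ((hs n).prob_preimage _).symm

variable [AddCommGroup G]

theorem eventually_exists_code_of_additive_noise {q : G → ℝ} (hq : q ∈ stdSimplex ℝ G)
    (hP : ∀ n, P n ∈ stdSimplex ℝ (Ω n)) {s : (n : ℕ) → Ω n → Fin n → G}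
    (hs : ∀ n, HasLaw (P n) (s n) (iidLaw q))
    (hr : r + shannonEntropy q < Real.logb 2 (Fintype.card G)) (hη : 0 < η) :
    ∀ᶠ n in atTop, ∃ (c : Fin (numMessages n r) → Fin n → G)
      (dec : (Fin n → G) → Fin (numMessages n r)),
      prob (prodLaw (uniformLaw _) (P n)) {x | dec (c x.1 + s n x.2) ≠ x.1} ≤ η := by
  obtain ⟨a, hqa, har⟩ := exists_between (lt_sub_iff_add_lt'.2 hr)
  have hlim := (tendsto_numMessages_sub_one_mul (r := r) (by linarith) (fun n => by positivity)
    (card_typicalSet_div_le hq a)).add (tendsto_prob_apply_notMem_typicalSet hq hs hqa)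
  rw [add_zero] at hlim
  filter_upwards [hlim.eventually_le_const hη] with n hn
  obtain ⟨c, dec, h⟩ := exists_code_of_additive_noise (ι := Fin (numMessages n r)) (hP n) (s n)
    (typicalSet q a n)
  rw [Fintype.card_fin] at h
  exact ⟨c, dec, h.trans hn⟩

theorem eventually_exists_code_of_additive_noise_and_description [AddCommGroup H]
    {q : G → ℝ} {q' : H → ℝ} (hq : q ∈ stdSimplex ℝ G) (hq' : q' ∈ stdSimplex ℝ H)
    (hP : ∀ n, P n ∈ stdSimplex ℝ (Ω n)) (s : (n : ℕ) → Ω n → Fin n → G)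
    {u : (n : ℕ) → Ω n → Fin n → G} {k : (n : ℕ) → Ω n → Fin n → H}
    (hu : ∀ n, HasLaw (P n) (u n) (iidLaw q)) (hk : ∀ n, HasLaw (P n) (k n) (iidLaw q'))
    (hr : r < Real.logb 2 (Fintype.card G))
    (hr' : r + (shannonEntropy q + shannonEntropy q') <
      Real.logb 2 (Fintype.card G) + Real.logb 2 (Fintype.card H)) (hη : 0 < η) :
    ∀ᶠ n in atTop, ∃ (c : Fin (numMessages n r) → Fin n → G) (F : (Fin n → G) → Fin n → H)
      (dec : (Fin n → G) × (Fin n → G) × (Fin n → H) → Fin (numMessages n r)),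
      prob (prodLaw (uniformLaw _) (P n)) {x | dec (c x.1 + s n x.2, c x.1 + u n x.2,
        F (s n x.2) + k n x.2) ≠ x.1} ≤ η := by
  obtain ⟨ε, hε, hεr⟩ : ∃ ε > 0, r + (shannonEntropy q + ε + (shannonEntropy q' + ε)) <
      Real.logb 2 (Fintype.card G) + Real.logb 2 (Fintype.card H) :=
    ⟨(Real.logb 2 (Fintype.card G) + Real.logb 2 (Fintype.card H) - r -
      shannonEntropy q - shannonEntropy q') / 3, by linarith, by linarith⟩
  set T := typicalSet q (shannonEntropy q + ε)
  set T' := typicalSet q' (shannonEntropy q' + ε)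
  have hsame := tendsto_numMessages_sub_one_mul (r := r) (a := -Real.logb 2 (Fintype.card G))
    (f := fun n => 1 / Fintype.card (Fin n → G)) (by linarith) (fun n => by positivity)
    fun n => by rw [card_pi_eq_two_rpow, mul_neg, Real.rpow_neg two_pos.le, one_div]
  have hdiff := tendsto_numMessages_sub_one_mul (r := r)
    (f := fun n => #(T n) / Fintype.card (Fin n → G) * (#(T' n) / Fintype.card (Fin n → H)))
    (a := shannonEntropy q + ε - Real.logb 2 (Fintype.card G) +
      (shannonEntropy q' + ε - Real.logb 2 (Fintype.card H))) (by linarith)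
    (fun n => by positivity) fun n => by
      rw [mul_add, Real.rpow_add two_pos]
      exact mul_le_mul (card_typicalSet_div_le hq _ n) (card_typicalSet_div_le hq' _ n)
        (by positivity) (by positivity)
  have hlim := (hsame.add hdiff).add
    ((tendsto_prob_apply_notMem_typicalSet hq hu (lt_add_of_pos_right _ hε)).add
      (tendsto_prob_apply_notMem_typicalSet hq' hk (lt_add_of_pos_right _ hε)))
  simp only [← mul_add, add_zero] at hlim
  filter_upwards [hlim.eventually_le_const hη] with n hn
  obtain ⟨c, F, dec, h⟩ := exists_code_of_additive_noise_and_description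
    (ι := Fin (numMessages n r)) (hP n) (s n) (u n) (k n) (T n) (T' n)
  rw [Fintype.card_fin] at h
  exact ⟨c, F, dec, h.trans hn⟩

end AsymptoticCoding

namespace FeedbackBlockCode

variable {X₁ X₂ X₃ Y₁ Y₂ Y₃ Z₁ Z₂ Z₃ V : Type} {M₁ M₂ M₃ N : ℕ}

/-- The output and feedback sequences `y` and `z` arise from the messages `w` and the noise `v`, on
a channel with output `out x v` and noiseless feedback `fb y`. -/
def Generates (c : FeedbackBlockCode X₁ X₂ X₃ Y₁ Y₂ Y₃ Z₁ Z₂ Z₃ M₁ M₂ M₃ N)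
    (out : X₁ × X₂ × X₃ → V → Y₁ × Y₂ × Y₃) (fb : Y₁ × Y₂ × Y₃ → Z₁ × Z₂ × Z₃)
    (w : Fin M₁ × Fin M₂ × Fin M₃) (v : Fin N → V)
    (y : Fin N → Y₁ × Y₂ × Y₃) (z : Fin N → Z₁ × Z₂ × Z₃) : Prop :=
  ∀ n, out (c.input w z n) (v n) = y n ∧ fb (y n) = z n

variable {c : FeedbackBlockCode X₁ X₂ X₃ Y₁ Y₂ Y₃ Z₁ Z₂ Z₃ M₁ M₂ M₃ N}
  {out : X₁ × X₂ × X₃ → V → Y₁ × Y₂ × Y₃} {fb : Y₁ × Y₂ × Y₃ → Z₁ × Z₂ × Z₃}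

theorem input_congr {w : Fin M₁ × Fin M₂ × Fin M₃} {z z' : Fin N → Z₁ × Z₂ × Z₃} {n : Fin N}
    (h : ∀ k < n, z k = z' k) : c.input w z n = c.input w z' n := by
  have hk (k : Fin n) : z (Fin.castLE n.isLt.le k) = z' (Fin.castLE n.isLt.le k) := h _ k.isLt
  simp only [input, hk]

theorem Generates.unique {w : Fin M₁ × Fin M₂ × Fin M₃} {v : Fin N → V}
    {y y' : Fin N → Y₁ × Y₂ × Y₃} {z z' : Fin N → Z₁ × Z₂ × Z₃}
    (h : c.Generates out fb w v y z) (h' : c.Generates out fb w v y' z') : y = y' ∧ z = z' := by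
  have hyz (n : Fin N) : y n = y' n ∧ z n = z' n := by
    induction n using WellFoundedLT.induction with
    | ind n ih =>
      have hy : y n = y' n := by
        rw [← (h n).1, ← (h' n).1, input_congr fun k hk => (ih k hk).2]
      exact ⟨hy, by rw [← (h n).2, ← (h' n).2, hy]⟩
  exact ⟨funext fun n => (hyz n).1, funext fun n => (hyz n).2⟩

variable [Fintype Y₁] [Fintype Y₂] [Fintype Y₃] [Fintype Z₁] [Fintype Z₂] [Fintype Z₃] [Fintype V]
  {C : ICFB X₁ X₂ X₃ Y₁ Y₂ Y₃ Z₁ Z₂ Z₃} {p : V → ℝ}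

theorem law_eq_prob_generates (hQ : ∀ x y, C.Q x y = prob p {v | out x v = y})
    (hP : ∀ y z, C.P y z = Set.indicator {y | fb y = z} 1 y) (w : Fin M₁ × Fin M₂ × Fin M₃)
    (y : Fin N → Y₁ × Y₂ × Y₃) (z : Fin N → Z₁ × Z₂ × Z₃) :
    c.law C w y z = prob (iidLaw p) {v | c.Generates out fb w v y z} := by
  have hpi : {v | c.Generates out fb w v y z} =
      Set.univ.pi fun n => {a | out (c.input w z n) a = y n ∧ fb (y n) = z n} := by
    ext v
    simp [Generates]
  rw [hpi, prob_iidLaw_pi, law]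
  refine prod_congr rfl fun n _ => ?_
  by_cases hz : fb (y n) = z n <;> simp [hQ, hP, hz, prob]

theorem errorProb_le_prob (hQ : ∀ x y, C.Q x y = prob p {v | out x v = y})
    (hP : ∀ y z, C.P y z = Set.indicator {y | fb y = z} 1 y) (hp : p ∈ stdSimplex ℝ V)
    {E : Set ((Fin M₁ × Fin M₂ × Fin M₃) × (Fin N → V))}
    (hE : ∀ w v y z, c.Generates out fb w v y z → c.decode y ≠ w → (w, v) ∈ E) :
    c.errorProb C ≤ prob (prodLaw (uniformLaw _) (iidLaw p)) E := by
  classical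
  rw [errorProb, prob_prodLaw, mul_sum]
  refine sum_le_sum fun w _ => ?_
  have hcard : ((M₁ : ℝ) * M₂ * M₃)⁻¹ = uniformLaw (Fin M₁ × Fin M₂ × Fin M₃) w := by
    simp [uniformLaw, mul_assoc]
  rw [hcard]
  refine mul_le_mul_of_nonneg_left ?_ (hcard ▸ by positivity)
  simp only [law_eq_prob_generates hQ hP]
  rw [← Fintype.sum_prod_type' (f := fun y z => if c.decode y = w then 0 else
    prob (iidLaw p) {v | c.Generates out fb w v y z}), sum_ite, sum_const_zero, zero_add]
  refine sum_prob_le_of_pairwiseDisjoint (iidLaw_mem_stdSimplex hp).1 ?_ fun x hx v hv =>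
    hE w v x.1 x.2 hv (mem_filter.1 hx).2
  refine fun x _ x' _ hne => Set.disjoint_left.2 fun v hv hv' => hne ?_
  exact Prod.ext (hv.unique hv').1 (hv.unique hv').2

end FeedbackBlockCode

namespace SecondExample

section Blocks

variable {V Z : Type} {B n m : ℕ}

/-- The `t`-th channel use of block `b`. -/
def slot (b : Fin B) (t : Fin n) : Fin (B * n) := finProdFinEquiv (b, t)

theorem divNat_slot (b : Fin B) (t : Fin n) : (slot b t).divNat = b :=
  congrArg Prod.fst (finProdFinEquiv.symm_apply_apply (b, t))

theorem modNat_slot (b : Fin B) (t : Fin n) : (slot b t).modNat = t :=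
  congrArg Prod.snd (finProdFinEquiv.symm_apply_apply (b, t))

theorem slot_castSucc_lt (b : Fin B) (t t' : Fin n) : slot b.castSucc t < slot b.succ t' := by
  change t + n * (b : ℕ) < t' + n * (b + 1 : ℕ)
  rw [Nat.mul_succ]
  omega

/-- The symbols of the block before the one of time `i`, among those received before time `i`;
symbols that do not exist are replaced by `0`. -/
def previousBlock [Zero Z] {i : Fin (B * n)} (z : Fin i → Z) (t : Fin n) : Z :=
  if h : t + n * (i.divNat - 1 : ℕ) < i then z ⟨_, h⟩ else 0

theorem previousBlock_slot_succ [Zero Z] (z : Fin ((B + 1) * n) → Z) (b : Fin B) (t : Fin n) :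
    previousBlock (fun k : Fin (slot b.succ t) => z (Fin.castLE (slot b.succ t).isLt.le k)) =
      fun t' => z (slot b.castSucc t') := by
  funext t'
  have hval : (slot b.castSucc t' : ℕ) = t' + n * ((slot b.succ t).divNat - 1 : ℕ) := by
    rw [divNat_slot, Fin.val_succ, Nat.add_sub_cancel]
    rfl
  have hlt := Fin.lt_def.1 (slot_castSucc_lt b t' t)
  rw [hval] at hlt
  rw [previousBlock, dif_pos hlt]
  exact congrArg z (Fin.ext hval.symm)

/-- The part of the message `w` that is sent in block `b`. -/
def submessage (w : Fin (m ^ B)) (b : Fin B) : Fin m := finFunctionFinEquiv.symm w b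

/-- The codeword sent in block `b`; it is zero in the last block, which carries no message. -/
def codeword [Zero Z] (c : Fin m → Fin n → Z) (w : Fin (m ^ B)) (b : ℕ) : Fin n → Z :=
  if h : b < B then c (submessage w ⟨b, h⟩) else 0

theorem codeword_val [Zero Z] (c : Fin m → Fin n → Z) (w : Fin (m ^ B)) (b : Fin B) :
    codeword c w b = c (submessage w b) := dif_pos b.isLt

/-- The symbols of block `b`, paired with those of the next block. -/
def blockPair (v : Fin ((B + 1) * n) → V) (b : Fin B) (t : Fin n) : V × V :=
  (v (slot b.castSucc t), v (slot b.succ t))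

theorem hasLaw_submessage (b : Fin B) [NeZero m] :
    HasLaw (uniformLaw (Fin (m ^ B))) (fun w => submessage w b) (uniformLaw (Fin m)) := by
  have happly : HasLaw (uniformLaw (Fin B → Fin m)) (fun s => s b) (uniformLaw (Fin m)) := by
    rw [uniformLaw_pi]
    exact hasLaw_iidLaw_apply uniformLaw_mem_stdSimplex b
  exact happly.comp (hasLaw_uniformLaw_equiv finFunctionFinEquiv.symm)

theorem hasLaw_blockPair [Fintype V] {p : V → ℝ} (hp : p ∈ stdSimplex ℝ V) (b : Fin B) :
    HasLaw (iidLaw p) (fun v : Fin ((B + 1) * n) → V => blockPair v b)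
      (iidLaw (prodLaw p p)) := by
  refine hasLaw_iidLaw_prodMk hp (Function.Injective.sumElim ?_ ?_ ?_)
  · exact fun t t' h => (Prod.ext_iff.1 (finProdFinEquiv.injective h)).2
  · exact fun t t' h => (Prod.ext_iff.1 (finProdFinEquiv.injective h)).2
  · exact fun t t' => (slot_castSucc_lt b t t').ne

theorem prob_exists_block_mem_le {W : Type} [Fintype W] [Nonempty W] [NeZero m] [Fintype V]
    {p : V → ℝ} (hp : p ∈ stdSimplex ℝ V) {f : W → Fin (m ^ B)}
    (hf : HasLaw (uniformLaw W) f (uniformLaw _)) (S : Set (Fin m × (Fin n → V × V))) :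
    prob (prodLaw (uniformLaw W) (iidLaw p))
        {x | ∃ b, (submessage (f x.1) b, blockPair x.2 b) ∈ S} ≤
      B * prob (prodLaw (uniformLaw (Fin m)) (iidLaw (prodLaw p p))) S := by
  have hlaw (b : Fin B) := (((hasLaw_submessage b).comp hf).prodMap
    (hasLaw_blockPair (n := n) hp b)).prob_preimage S
  have hunion := prob_setOf_exists_mem_le (prodLaw_mem_stdSimplex
    (uniformLaw_mem_stdSimplex (α := W)) (iidLaw_mem_stdSimplex hp)).1 univ
    fun b => Prod.map (fun w => submessage (f w) b) (blockPair (n := n) · b) ⁻¹' S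
  simp only [mem_univ, true_and, hlaw, sum_const, card_univ, Fintype.card_fin,
    nsmul_eq_mul] at hunion
  exact hunion

end Blocks

section BlockMarkovCode

/-- A value of the noise bits `(N₁, N₃, N_δ, E)`. -/
abbrev Noise := Bool × Bool × Bool × Bool

/-- The feedback-block-codes for the channel of this example. -/
abbrev ChannelCode (M₁ M₂ M₃ N : ℕ) :=
  FeedbackBlockCode (ZMod 3 × Bool) Bool (Bool × Bool × Bool)
    (ZMod 3) (Bool × Bool × Bool) (Bool × Bool) (ZMod 3) Unit (Bool × Bool) M₁ M₂ M₃ N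

variable {B n m₁ m₂ m₃ : ℕ}

/-- The block Markov code: in each block the three transmitters send codewords of their current
submessages, and one block later transmitter 1 forwards the bits `E` uncoded and transmitter 3
sends the description `F` of the sequence `E ⊕ N_δ`. Decoder `i` applies `dᵢ` to the signals of
each block, from which decoder 2 has removed the forwarded bits. -/
def blockCode (B : ℕ) (c₁ : Fin m₁ → Fin n → ZMod 3) (c₂ : Fin m₂ → Fin n → Bool)
    (F : (Fin n → Bool) → Fin n → Bool) (c₃ : Fin m₃ → Fin n → Bool)
    (d₁ : (Fin n → ZMod 3) → Fin m₁)
    (d₂ : (Fin n → Bool) × (Fin n → Bool) × (Fin n → Bool) → Fin m₂)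
    (d₃ : (Fin n → Bool) → Fin m₃) :
    ChannelCode (m₁ ^ B) (m₂ ^ B) (m₃ ^ B) ((B + 1) * n) where
  enc₁ i w z := (codeword c₁ w i.divNat i.modNat,
    decide ((previousBlock z - codeword c₁ w (i.divNat - 1 : ℕ)) i.modNat = 1))
  enc₂ i w _ := codeword c₂ w i.divNat i.modNat
  enc₃ i w z := (F ((fun t => (previousBlock z t).1 + (previousBlock z t).2) -
      codeword c₃ w (i.divNat - 1 : ℕ)) i.modNat,
    codeword c₃ w i.divNat i.modNat, false)
  dec₁ y := finFunctionFinEquiv fun b => d₁ fun t => y (slot b.castSucc t)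
  dec₂ y := finFunctionFinEquiv fun b => d₂ (fun t => (y (slot b.castSucc t)).1,
    fun t => (y (slot b.castSucc t)).1 + (y (slot b.succ t)).2.1, fun t => (y (slot b.succ t)).2.2)
  dec₃ y := finFunctionFinEquiv fun b => d₃ fun t => (y (slot b.castSucc t)).1

/-- The noise `E` of receiver 1 in a block. As in the definitions below, the components of `u t` are
the noise bits in the block and in the next one. -/
def noiseOne (u : Fin n → Noise × Noise) (t : Fin n) : ZMod 3 := toTernary (u t).1.2.2.2

/-- The noise `E ⊕ N_δ` of the signal of transmitter 2 in a block. -/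
def noiseTwo (u : Fin n → Noise × Noise) (t : Fin n) : Bool := (u t).1.2.2.2 + (u t).1.2.2.1

/-- The noise `N_δ ⊕ N₁` that is left at receiver 2 when the forwarded bits are removed. -/
def noiseLeft (u : Fin n → Noise × Noise) (t : Fin n) : Bool := (u t).2.1 + (u t).1.2.2.1

/-- The noise `N₃` of the description sent in the next block. -/
def noiseDescription (u : Fin n → Noise × Noise) (t : Fin n) : Bool := (u t).2.2.1

/-- The noise `N_δ` of receiver 3 in a block. -/
def noiseThree (u : Fin n → Noise × Noise) (t : Fin n) : Bool := (u t).1.2.2.1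

variable {c₁ : Fin m₁ → Fin n → ZMod 3} {c₂ : Fin m₂ → Fin n → Bool}
  {F : (Fin n → Bool) → Fin n → Bool} {c₃ : Fin m₃ → Fin n → Bool}
  {d₁ : (Fin n → ZMod 3) → Fin m₁}
  {d₂ : (Fin n → Bool) × (Fin n → Bool) × (Fin n → Bool) → Fin m₂} {d₃ : (Fin n → Bool) → Fin m₃}
  {w : Fin (m₁ ^ B) × Fin (m₂ ^ B) × Fin (m₃ ^ B)} {v : Fin ((B + 1) * n) → Noise}
  {y : Fin ((B + 1) * n) → ZMod 3 × (Bool × Bool × Bool) × (Bool × Bool)}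
  {z : Fin ((B + 1) * n) → ZMod 3 × Unit × (Bool × Bool)}

theorem output_blockCode_castSucc
    (h : (blockCode B c₁ c₂ F c₃ d₁ d₂ d₃).Generates output (feedback · false) w v y z) (b : Fin B)
    (t : Fin n) :
    (y (slot b.castSucc t)).1 = c₁ (submessage w.1 b) t + noiseOne (blockPair v b) t ∧
      (y (slot b.castSucc t)).2.1.1 =
        c₂ (submessage w.2.1 b) t + noiseTwo (blockPair v b) t ∧
      (y (slot b.castSucc t)).2.2 =
        (c₃ (submessage w.2.2 b) t + noiseThree (blockPair v b) t,
          (v (slot b.castSucc t)).2.2.2) := by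
  rw [← (h _).1]
  simp only [FeedbackBlockCode.input, blockCode, divNat_slot, modNat_slot, Fin.val_castSucc,
    codeword_val]
  exact ⟨rfl, rfl, Prod.ext rfl (Bool.false_xor _)⟩

theorem feedback_eq
    (h : (blockCode B c₁ c₂ F c₃ d₁ d₂ d₃).Generates output (feedback · false) w v y z) (i) :
    z i = ((y i).1, (), (y i).2.2) := by
  simp [← (h i).2, feedback, toTernary]

theorem decide_toTernary_eq_one (e : Bool) : decide (toTernary e = 1) = e := by
  cases e <;> decide

theorem output_two_succ
    (h : (blockCode B c₁ c₂ F c₃ d₁ d₂ d₃).Generates output (feedback · false) w v y z) (b : Fin B)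
    (t : Fin n) : (y (slot b.succ t)).2.1.2 =
      ((v (slot b.castSucc t)).2.2.2 + (v (slot b.succ t)).1,
        F (noiseTwo (blockPair v b)) t + noiseDescription (blockPair v b) t) := by
  have hone : (fun t => (z (slot b.castSucc t)).1) - c₁ (submessage w.1 b) =
      noiseOne (blockPair v b) := by
    funext t
    rw [Pi.sub_apply, feedback_eq h, (output_blockCode_castSucc h b t).1, add_sub_cancel_left]
  have htwo : (fun t => (z (slot b.castSucc t)).2.2.1 + (z (slot b.castSucc t)).2.2.2) -
      c₃ (submessage w.2.2 b) = noiseTwo (blockPair v b) := by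
    funext t
    rw [Pi.sub_apply, feedback_eq h, (output_blockCode_castSucc h b t).2.2, add_assoc,
      add_sub_cancel_left, add_comm]
    rfl
  rw [← (h _).1]
  simp only [FeedbackBlockCode.input, blockCode, divNat_slot, modNat_slot, Fin.val_succ,
    Nat.add_sub_cancel, codeword_val, previousBlock_slot_succ (fun i => (z i).1),
    previousBlock_slot_succ (fun i => (z i).2.2), hone, htwo]
  exact Prod.ext (congrArg (xor · _) (decide_toTernary_eq_one _)) rfl

theorem noiseTwo_add_forwarded (u : Fin n → Noise × Noise) (t : Fin n) :
    noiseTwo u t + ((u t).1.2.2.2 + (u t).2.1) = noiseLeft u t := by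
  rw [noiseTwo, noiseLeft, add_comm (u t).1.2.2.2, add_assoc, ← add_assoc (u t).1.2.2.2,
    BooleanRing.add_self, zero_add, add_comm]

theorem output_two_add_forwarded
    (h : (blockCode B c₁ c₂ F c₃ d₁ d₂ d₃).Generates output (feedback · false) w v y z) (b : Fin B)
    (t : Fin n) : (y (slot b.castSucc t)).2.1.1 + (y (slot b.succ t)).2.1.2.1 =
      c₂ (submessage w.2.1 b) t + noiseLeft (blockPair v b) t := by
  rw [(output_blockCode_castSucc h b t).2.1, output_two_succ h, add_assoc]
  exact congrArg _ (noiseTwo_add_forwarded (blockPair v b) t)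

theorem exists_block_error
    (h : (blockCode B c₁ c₂ F c₃ d₁ d₂ d₃).Generates output (feedback · false) w v y z)
    (hd : (blockCode B c₁ c₂ F c₃ d₁ d₂ d₃).decode y ≠ w) :
    (∃ b, d₁ (c₁ (submessage w.1 b) + noiseOne (blockPair v b)) ≠ submessage w.1 b) ∨
    (∃ b, d₂ (c₂ (submessage w.2.1 b) + noiseTwo (blockPair v b),
      c₂ (submessage w.2.1 b) + noiseLeft (blockPair v b),
      F (noiseTwo (blockPair v b)) + noiseDescription (blockPair v b)) ≠ submessage w.2.1 b) ∨
    ∃ b, d₃ (c₃ (submessage w.2.2 b) + noiseThree (blockPair v b)) ≠ submessage w.2.2 b := by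
  contrapose! hd
  refine Prod.ext ?_ (Prod.ext ?_ ?_) <;> refine (Equiv.eq_symm_apply _).1 (funext fun b => ?_)
  · refine (congrArg d₁ (funext fun t => ?_)).trans (hd.1 b)
    exact (output_blockCode_castSucc h b t).1
  · refine (congrArg d₂ (Prod.ext (funext fun t => ?_) (Prod.ext (funext fun t => ?_)
      (funext fun t => ?_)))).trans (hd.2.1 b)
    · exact (output_blockCode_castSucc h b t).2.1
    · exact output_two_add_forwarded h b t
    · exact congrArg Prod.snd (output_two_succ h b t)
  · refine (congrArg d₃ (funext fun t => ?_)).trans (hd.2.2 b)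
    exact congrArg Prod.fst (output_blockCode_castSucc h b t).2.2

theorem bern_mem_stdSimplex {p : ℝ} (hp : p ∈ unitInterval) : bern p ∈ stdSimplex ℝ Bool :=
  ⟨bern_nonneg ⟨p, hp⟩, by simp [bern]⟩

theorem bern_one_half_mem_stdSimplex : bern (1 / 2) ∈ stdSimplex ℝ Bool :=
  bern_mem_stdSimplex ⟨by norm_num, by norm_num⟩

theorem noiseLaw_eq_prodLaw (p₁ p₃ δ : ℝ) : noiseLaw p₁ p₃ δ =
    prodLaw (bern p₁) (prodLaw (bern p₃) (prodLaw (bern δ) (bern (1 / 2)))) := by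
  funext v
  simp only [noiseLaw, prodLaw, mul_assoc]

variable (p₁ p₃ δ : unitInterval)

theorem noiseLaw_mem_stdSimplex : noiseLaw p₁ p₃ δ ∈ stdSimplex ℝ Noise := by
  rw [noiseLaw_eq_prodLaw]
  exact prodLaw_mem_stdSimplex (bern_mem_stdSimplex p₁.2) (prodLaw_mem_stdSimplex
    (bern_mem_stdSimplex p₃.2) (prodLaw_mem_stdSimplex (bern_mem_stdSimplex δ.2)
      bern_one_half_mem_stdSimplex))

/-- The mass function of a block of noise bits, paired with those of the next block. -/
noncomputable def blockPairLaw (n : ℕ) : (Fin n → Noise × Noise) → ℝ :=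
  iidLaw (prodLaw (noiseLaw p₁ p₃ δ) (noiseLaw p₁ p₃ δ))

theorem errorProb_blockCode_le [NeZero m₁] [NeZero m₂] [NeZero m₃] :
    (blockCode B c₁ c₂ F c₃ d₁ d₂ d₃).errorProb (channel p₁ p₃ δ 0) ≤
      B * prob (prodLaw (uniformLaw (Fin m₁)) (blockPairLaw p₁ p₃ δ n))
          {x | d₁ (c₁ x.1 + noiseOne x.2) ≠ x.1} +
        (B * prob (prodLaw (uniformLaw (Fin m₂)) (blockPairLaw p₁ p₃ δ n))
            {x | d₂ (c₂ x.1 + noiseTwo x.2, c₂ x.1 + noiseLeft x.2,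
              F (noiseTwo x.2) + noiseDescription x.2) ≠ x.1} +
          B * prob (prodLaw (uniformLaw (Fin m₃)) (blockPairLaw p₁ p₃ δ n))
            {x | d₃ (c₃ x.1 + noiseThree x.2) ≠ x.1}) := by
  have hnoise := noiseLaw_mem_stdSimplex p₁ p₃ δ
  have hpos := (prodLaw_mem_stdSimplex
    (uniformLaw_mem_stdSimplex (α := Fin (m₁ ^ B) × Fin (m₂ ^ B) × Fin (m₃ ^ B)))
    (iidLaw_mem_stdSimplex (ι := Fin ((B + 1) * n)) hnoise)).1
  refine le_trans ?_ ((prob_union_le hpos _ _).trans (add_le_add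
    (prob_exists_block_mem_le hnoise hasLaw_uniformLaw_fst _)
    ((prob_union_le hpos _ _).trans (add_le_add
      (prob_exists_block_mem_le hnoise (hasLaw_uniformLaw_fst.comp hasLaw_uniformLaw_snd) _)
      (prob_exists_block_mem_le hnoise (hasLaw_uniformLaw_snd.comp hasLaw_uniformLaw_snd) _)))))
  refine FeedbackBlockCode.errorProb_le_prob (out := output) (fb := (feedback · false))
    (fun x y => ?_) (fun y z => ?_) hnoise fun w v y z => exists_block_error
  · simp [channel, prob, Set.indicator_apply]
  · simp [channel, bern, Set.indicator_apply]

end BlockMarkovCode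

end SecondExample

theorem hasLaw_add_bern (p q : ℝ) :
    HasLaw (prodLaw (bern p) (bern q)) (fun x => x.1 + x.2) (bern (binConv p q)) := by
  classical
  intro b
  simp only [prob, Set.indicator_apply, Fintype.sum_prod_type, Fintype.sum_bool, prodLaw]
  cases b <;> simp [bern, binConv, Bool.add_eq_xor]
  ring

theorem binConv_comm (p q : ℝ) : binConv p q = binConv q p := by
  unfold binConv
  ring

theorem binConv_mem_unitInterval (p q : unitInterval) : binConv p q ∈ unitInterval := by
  obtain ⟨p, hp₀, hp₁⟩ := p
  obtain ⟨q, hq₀, hq₁⟩ := q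
  constructor <;> simp only [binConv] <;> nlinarith

theorem shannonEntropy_bern (p : ℝ) : shannonEntropy (bern p) = hb p := by
  simp [shannonEntropy, hb, bern, Real.binEntropy_eq_negMulLog_add_negMulLog_one_sub]

theorem continuous_hb : Continuous hb := Real.binEntropy_continuous.div_const _

theorem hb_nonneg {p : ℝ} (hp : p ∈ unitInterval) : 0 ≤ hb p :=
  div_nonneg (Real.binEntropy_nonneg hp.1 hp.2) (Real.log_nonneg one_le_two)

theorem hb_le_one (p : ℝ) : hb p ≤ 1 :=
  (div_le_one (Real.log_pos one_lt_two)).2 Real.binEntropy_le_log_two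

theorem hb_zero : hb 0 = 0 := by simp [hb]

theorem hb_one_half : hb (1 / 2) = 1 := by
  rw [hb, one_div, Real.binEntropy_two_inv, div_self (Real.log_pos one_lt_two).ne']

theorem hb_hbInv {x : ℝ} (hx : x ∈ unitInterval) : hb (hbInv x) = x := by
  have himage := intermediate_value_Icc (by norm_num) (continuous_hb.continuousOn
    (s := Set.Icc 0 (1 / 2)))
  rw [hb_zero, hb_one_half] at himage
  exact Function.invFunOn_eq (himage hx)

namespace SecondExample

/-- The mass function of the noise `E` of receiver 1, a uniform bit read modulo 3. -/
noncomputable def ternaryLaw : ZMod 3 → ℝ := ![1 / 2, 1 / 2, 0]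

theorem sum_ternaryLaw (f : ℝ → ℝ) : ∑ x, f (ternaryLaw x) = f (1 / 2) + f (1 / 2) + f 0 :=
  Fin.sum_univ_three fun x => f (ternaryLaw x)

theorem ternaryLaw_mem_stdSimplex : ternaryLaw ∈ stdSimplex ℝ (ZMod 3) := by
  refine ⟨fun x => ?_, (sum_ternaryLaw id).trans (by norm_num)⟩
  fin_cases x <;> simp [ternaryLaw]

theorem shannonEntropy_ternaryLaw : shannonEntropy ternaryLaw = 1 := by
  rw [shannonEntropy, sum_ternaryLaw, Real.negMulLog_zero, add_zero,
    div_eq_one_iff_eq (Real.log_pos one_lt_two).ne', Real.negMulLog, one_div, Real.log_inv]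
  ring

theorem hasLaw_toTernary : HasLaw (bern (1 / 2)) toTernary ternaryLaw := by
  classical
  intro x
  have hval : ternaryLaw 0 = 1 / 2 ∧ ternaryLaw 1 = 1 / 2 ∧ ternaryLaw 2 = 0 := ⟨rfl, rfl, rfl⟩
  have hne : (0 : ZMod 3) ≠ 2 ∧ (1 : ZMod 3) ≠ 2 := by decide
  simp only [prob, Set.indicator_apply, Fintype.sum_bool, Set.mem_preimage, Set.mem_singleton_iff]
  obtain rfl | rfl | rfl : x = 0 ∨ x = 1 ∨ x = 2 := by decide +revert
  all_goals norm_num [toTernary, bern, hval, hne]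

section NoiseLaws

variable (p₁ p₃ δ : unitInterval) (n : ℕ)

theorem hasLaw_noiseLaw_one : HasLaw (noiseLaw p₁ p₃ δ) (fun v => v.1) (bern p₁) := by
  rw [noiseLaw_eq_prodLaw]
  exact hasLaw_fst _ (prodLaw_mem_stdSimplex (bern_mem_stdSimplex p₃.2)
    (prodLaw_mem_stdSimplex (bern_mem_stdSimplex δ.2)
      bern_one_half_mem_stdSimplex))

theorem hasLaw_noiseLaw_three : HasLaw (noiseLaw p₁ p₃ δ) (fun v => v.2.1) (bern p₃) := by
  rw [noiseLaw_eq_prodLaw]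
  exact (hasLaw_fst _ (prodLaw_mem_stdSimplex (bern_mem_stdSimplex δ.2)
      bern_one_half_mem_stdSimplex)).comp
    (hasLaw_snd (bern_mem_stdSimplex p₁.2) _)

theorem hasLaw_noiseLaw_delta : HasLaw (noiseLaw p₁ p₃ δ) (fun v => v.2.2.1) (bern δ) := by
  rw [noiseLaw_eq_prodLaw]
  exact (hasLaw_fst _ bern_one_half_mem_stdSimplex).comp
    ((hasLaw_snd (bern_mem_stdSimplex p₃.2) _).comp (hasLaw_snd (bern_mem_stdSimplex p₁.2) _))

theorem hasLaw_noiseLaw_fair : HasLaw (noiseLaw p₁ p₃ δ) (fun v => v.2.2.2) (bern (1 / 2)) := by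
  rw [noiseLaw_eq_prodLaw]
  exact (hasLaw_snd (bern_mem_stdSimplex δ.2) _).comp
    ((hasLaw_snd (bern_mem_stdSimplex p₃.2) _).comp (hasLaw_snd (bern_mem_stdSimplex p₁.2) _))

theorem blockPairLaw_mem_stdSimplex : blockPairLaw p₁ p₃ δ n ∈ stdSimplex ℝ _ :=
  iidLaw_mem_stdSimplex (prodLaw_mem_stdSimplex (noiseLaw_mem_stdSimplex p₁ p₃ δ)
    (noiseLaw_mem_stdSimplex p₁ p₃ δ))

variable {n}

theorem hasLaw_noiseOne : HasLaw (blockPairLaw p₁ p₃ δ n) noiseOne (iidLaw ternaryLaw) :=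
  ((hasLaw_toTernary.comp (hasLaw_noiseLaw_fair p₁ p₃ δ)).comp
    (hasLaw_fst _ (noiseLaw_mem_stdSimplex p₁ p₃ δ))).iidLaw

theorem hasLaw_noiseLeft :
    HasLaw (blockPairLaw p₁ p₃ δ n) noiseLeft (iidLaw (bern (binConv p₁ δ))) := by
  have hsum := (hasLaw_add_bern δ p₁).comp
    ((hasLaw_noiseLaw_delta p₁ p₃ δ).prodMap (hasLaw_noiseLaw_one p₁ p₃ δ))
  have hfun : (noiseLeft : (Fin n → _) → _) = fun u t => (u t).1.2.2.1 + (u t).2.1 :=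
    funext₂ fun u t => add_comm _ _
  rw [hfun, binConv_comm]
  exact hsum.iidLaw

theorem hasLaw_noiseDescription :
    HasLaw (blockPairLaw p₁ p₃ δ n) noiseDescription (iidLaw (bern p₃)) :=
  ((hasLaw_noiseLaw_three p₁ p₃ δ).comp
    (hasLaw_snd (noiseLaw_mem_stdSimplex p₁ p₃ δ) _)).iidLaw

theorem hasLaw_noiseThree : HasLaw (blockPairLaw p₁ p₃ δ n) noiseThree (iidLaw (bern δ)) :=
  ((hasLaw_noiseLaw_delta p₁ p₃ δ).comp
    (hasLaw_fst _ (noiseLaw_mem_stdSimplex p₁ p₃ δ))).iidLaw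

end NoiseLaws

theorem logb_two_card_bool : Real.logb 2 (Fintype.card Bool) = 1 := by simp

theorem eventually_exists_code (p₁ p₃ δ : unitInterval) (B : ℕ) {r₁ r₂ r₃ η : ℝ}
    (hr₁ : r₁ < Real.logb 2 3 - 1) (hr₂ : r₂ < 1)
    (hr₂' : r₂ + (hb (binConv p₁ δ) + hb p₃) < 2) (hr₃ : r₃ < 1 - hb δ) (hη : 0 < η) :
    ∀ᶠ n in atTop, ∃ c : ChannelCode (numMessages n r₁ ^ B) (numMessages n r₂ ^ B)
      (numMessages n r₃ ^ B) ((B + 1) * n), c.errorProb (channel p₁ p₃ δ 0) ≤ η := by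
  have hη' : 0 < η / (3 * (B + 1)) := by positivity
  have hP := blockPairLaw_mem_stdSimplex p₁ p₃ δ
  filter_upwards [
    eventually_exists_code_of_additive_noise ternaryLaw_mem_stdSimplex hP
      (fun _ => hasLaw_noiseOne p₁ p₃ δ) (r := r₁)
      (by rw [shannonEntropy_ternaryLaw, ZMod.card]; exact lt_sub_iff_add_lt.1 hr₁) hη',
    eventually_exists_code_of_additive_noise_and_description
      (bern_mem_stdSimplex (binConv_mem_unitInterval p₁ δ)) (bern_mem_stdSimplex p₃.2) hP
      (fun _ => noiseTwo) (fun _ => hasLaw_noiseLeft p₁ p₃ δ)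
      (fun _ => hasLaw_noiseDescription p₁ p₃ δ) (r := r₂) (by rwa [logb_two_card_bool])
      (by rw [shannonEntropy_bern, shannonEntropy_bern, logb_two_card_bool]; linarith) hη',
    eventually_exists_code_of_additive_noise (bern_mem_stdSimplex δ.2) hP
      (fun _ => hasLaw_noiseThree p₁ p₃ δ) (r := r₃)
      (by rw [shannonEntropy_bern, logb_two_card_bool]; linarith) hη']
    with n ⟨c₁, d₁, h₁⟩ ⟨c₂, F, d₂, h₂⟩ ⟨c₃, d₃, h₃⟩
  refine ⟨blockCode B c₁ c₂ F c₃ d₁ d₂ d₃, (errorProb_blockCode_le p₁ p₃ δ).trans ?_⟩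
  calc _ ≤ B * (η / (3 * (B + 1))) + (B * (η / (3 * (B + 1))) + B * (η / (3 * (B + 1)))) := by
        gcongr
    _ = B / (B + 1) * η := by
        field_simp
        ring
    _ ≤ η := mul_le_of_le_one_left hη.le (div_le_one_of_le₀ (by simp) (by positivity))

end SecondExample

theorem lemma3_general (p₁ p₃ δ : unitInterval) :
    (SecondExample.channel p₁ p₃ δ 0).Achievable
      (Real.logb 2 3 - 1)
      (1 - hb (hbInv (max (hb (binConv p₁ δ) + hb p₃ - 1) 0)))
      (1 - hb δ) := by
  intro η hη
  set h := hb (binConv p₁ δ) + hb p₃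
  rw [hb_hbInv ⟨le_max_right _ _, max_le (by linarith [hb_le_one (binConv p₁ δ), hb_le_one p₃])
    zero_le_one⟩]
  have hlogb : Real.logb 2 3 ≤ 2 := by
    rw [Real.logb_le_iff_le_rpow one_lt_two (by norm_num)]
    norm_num
  have hmax := le_max_left (h - 1) 0
  have hmax' := le_max_right (h - 1) 0
  obtain ⟨B, hB⟩ := exists_nat_ge (2 / η)
  obtain ⟨n, ⟨c, hc⟩, hn⟩ := ((SecondExample.eventually_exists_code p₁ p₃ δ B
    (r₁ := Real.logb 2 3 - 1 - η / 2) (r₂ := 1 - max (h - 1) 0 - η / 2) (r₃ := 1 - hb δ - η / 2)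
    (by linarith) (by linarith) (by linarith) (by linarith) hη).and (eventually_gt_atTop 0)).exists
  refine ⟨_, _, _, _, NeZero.pos _, NeZero.pos _, NeZero.pos _, by positivity, c, hc, ?_, ?_, ?_⟩
    <;> refine sub_le_rate_of_mul_le_logb hn hη ?_ hB (mul_le_logb_numMessages _ _)
  · linarith
  · linarith
  · linarith [hb_nonneg δ.2]

theorem lemma3 (p₁ p₃ δ : unitInterval)
    (hp₁ : (p₁ : ℝ) < 1 / 2) (hp₃ : (p₃ : ℝ) < 1 / 2) (hδ : (δ : ℝ) < 1 / 2) :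
    (SecondExample.channel p₁ p₃ δ 0).Achievable
      (Real.logb 2 3 - 1)
      (1 - hb (hbInv (max (hb (binConv p₁ δ) + hb p₃ - 1) 0)))
      (1 - hb δ) :=
  lemma3_general p₁ p₃ δ
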